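/- **Conventions.** For $v\in\{0,1\}^n$ let $|v|$ be the number of coordinates equal to $1$. A morphism $\{0,1\}^m\to\{0,1\}^n$ is the restriction of an affine homomorphism $\mathbb Z^m\to\mathbb Z^n$; a bijective morphism $\{0,1\}^n\to\{0,1\}^n$ is an automorphism, and $r(\theta)=|\theta(0^n)|$. An $m$-face of $\{0,1\}^n$ is a subset obtained by fixing $n-m$ coordinates; an $m$-face map is an injective morphism $\{0,1\}^m\to\{0,1\}^n$ whose image is an $m$-face; the restriction of a map to a face $F$ is its composition with the face map $\phi_F$ with image $F$ that neither reflects nor permutes coordinates. For $g:\{0,1\}^n\to Z$, with $Z$ an abelian group, put $\sigma_n(g)=\sum_{v}(-1)^{|v|}g(v)$. A *cubespace* is a set $Y$ with sets $C^n(Y)\subset Y^{\{0,1\}^n}$ ($n\ge 0$) of cubes such that $C^0(Y)=Y$ and $q\circ\phi\in C^m(Y)$ for every $q\in C^n(Y)$ and every morphism $\phi:\{0,1\}^m\to\{0,1\}^n$. A *nilspace* is a cubespace $X$ such that $C^1(X)=X^{\{0,1\}}$ and, for every $n\ge 1$, every map $q':\{0,1\}^n\setminus\{1^n\}\to X$ whose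 restrictions to the $(n-1)$-faces containing $0^n$ are all cubes extends to an $n$-cube. Two cubespaces are isomorphic if there is a bijection between them such that it and its inverse map cubes to cubes. For $k\ge 0$, $\mathcal D_k(Z)$ is the group $Z$ with $C^n(\mathcal D_k(Z))$ the set of $q:\{0,1\}^n\to Z$ such that $\sigma_{k+1}(q\circ\phi)=0$ for every $(k+1)$-face map $\phi:\{0,1\}^{k+1}\to\{0,1\}^n$. Let $X$ be a nilspace, $Z$ an abelian group and $k\ge 0$ an integer. A *degree-$k$ extension of $X$ by $Z$* is a cubespace $Y$ with a free action of $Z$ and a map $\pi:Y\to X$ such that $x\mapsto\pi^{-1}(x)$ is a bijection from $X$ to the set of orbits and, for every $n\ge0$: (i) $q\mapsto\pi\circ q$ maps $C^n(Y)$ onto $C^n(X)$; (ii) for every $q_1\in C^n(Y)$, $\{q_2\in C^n(Y):\pi\circ q_2=\pi\circ q_1\}=\{q_1+q_3:q_3\in C^n(\mathcal D_k(Z))\}$. A *cocycle of degree $k$* is a function $\rho:C^{k+1}(X)\to Z$ such that $\rho(q\circ\theta)=(-1)^{r(\theta)}\rho(q)$ for every automorphism $\theta$ of $\{0,1\}^{k+1}$,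 and $\rho(q_3)=\rho(q_1)+\rho(q_2)$ whenever $q_1(\cdot,1)=q_2(\cdot,0)$, $q_3(\cdot,0)=q_1(\cdot,0)$ and $q_3(\cdot,1)=q_2(\cdot,1)$. Under pointwise addition these form a group $Y_k(X,Z)$; the coboundaries, i.e. the cocycles of the form $q\mapsto\sigma_{k+1}(f\circ q)$ with $f:X\to Z$, form a subgroup, and $H_k(X,Z)$ is the quotient group. For a cocycle $\rho$ of degree $k$ and $x\in X$, let $\rho_x$ be the restriction of $\rho$ to $\{q\in C^{k+1}(X):q(0^{k+1})=x\}$. Let $M(\rho)=\bigcup_{x\in X}\{\rho_x+z:z\in Z\}$, with $\tilde\pi(\rho_x+z)=x$ and with $Z$ acting by $(\rho_x+z,z')\mapsto\rho_x+z+z'$. A map $f:\{0,1\}^{k+1}\to M(\rho)$ is a $(k+1)$-cube if $\tilde\pi\circ f\in C^{k+1}(X)$ and $\rho(\tilde\pi\circ f)=\sigma_{k+1}(a)$, where $a(v)=\rho_{\tilde\pi(f(v))}-f(v)\in Z$. For $n\ne k+1$, a map $f:\{0,1\}^n\to M(\rho)$ is an $n$-cube if $\tilde\pi\circ f\in C^n(X)$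 and the restriction of $f$ to every $(k+1)$-face is a $(k+1)$-cube. **Statement.** For every cocycle $\rho$ of degree $k$, $M(\rho)$ is a degree-$k$ extension of $X$ by $Z$, and the isomorphism class of $M(\rho)$ depends only on the class of $\rho$ in $H_k(X,Z)$. The resulting map $\Phi$, which sends a class $C\in H_k(X,Z)$ to the isomorphism class of $M(\rho)$ for any $\rho\in C$, is a surjection from $H_k(X,Z)$ onto the set of isomorphism classes of degree-$k$ extensions of $X$ by $Z$. -/

import Mathlib

namespace CubeNil

universe u v

/-- The discrete `n`-cube `{0,1}^n`; `false` stands for `0` and `true` for `1`. -/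
abbrev Vertex (n : ℕ) : Type := Fin n → Bool

/-- The inclusion `{0,1}^n ⊆ ℤ^n`. -/
def Vertex.toInt {n : ℕ} (v : Vertex n) : Fin n → ℤ := fun i => if v i then 1 else 0

/-- `|v|`, the number of coordinates of `v` equal to `1`. -/
def Vertex.weight {n : ℕ} (v : Vertex n) : ℕ := (Finset.univ.filter fun i => v i = true).card

/-- A discrete-cube morphism: the restriction of an affine homomorphism `ℤ^m → ℤ^n`. -/
def IsCubeMorphism {m n : ℕ} (φ : Vertex m → Vertex n) : Prop :=
  ∃ (L : (Fin m → ℤ) →+ (Fin n → ℤ)) (t : Fin n → ℤ), ∀ v, (φ v).toInt = L v.toInt + t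

/-- An automorphism of the discrete `n`-cube: a bijective morphism. -/
def IsCubeAut {n : ℕ} (θ : Vertex n → Vertex n) : Prop :=
  IsCubeMorphism θ ∧ Function.Bijective θ

/-- The number of reflections involved in `θ`: the number of coordinates of `θ(0^n)` equal
to `1`. -/
def reflections {n : ℕ} (θ : Vertex n → Vertex n) : ℕ := (θ fun _ => false).weight

/-- An `m`-face of `{0,1}^n`: the set obtained by fixing `n - m` of the coordinates. -/
def IsFace {n : ℕ} (m : ℕ) (F : Set (Vertex n)) : Prop :=
  ∃ (I : Finset (Fin n)) (x : Vertex n), I.card + m = n ∧ F = {v | ∀ i ∈ I, v i = x i}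

/-- An `m`-face map: an injective morphism whose image is an `m`-face. -/
def IsFaceMap {m n : ℕ} (φ : Vertex m → Vertex n) : Prop :=
  IsCubeMorphism φ ∧ Function.Injective φ ∧ IsFace m (Set.range φ)

/-- The maps `φ_F`: the `m`-face map with image `F` that neither reflects nor permutes
coordinates. The face restriction of `g` to `F` is `g ∘ φ_F`. -/
def IsStandardFaceMap {m n : ℕ} (φ : Vertex m → Vertex n) : Prop :=
  ∃ (e : Fin m ↪o Fin n) (x : Vertex n), ∀ v : Vertex m,
    (∀ i, φ v (e i) = v i) ∧ ∀ j, j ∉ Set.range e → φ v j = x j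

/-- A set together with a collection `cu n` of maps `{0,1}^n → X` for every `n ≥ 0`
(no axiom yet). -/
class CubeStructure (X : Type u) where
  cu : (n : ℕ) → Set (Vertex n → X)

/-- The set of `n`-cubes on `X`. -/
def Cu (X : Type u) [CubeStructure X] (n : ℕ) : Set (Vertex n → X) := CubeStructure.cu n

/-- The composition axiom. -/
def CompositionAxiom (X : Type u) [CubeStructure X] : Prop :=
  ∀ (m n : ℕ) (φ : Vertex m → Vertex n), IsCubeMorphism φ → ∀ q ∈ Cu X n, q ∘ φ ∈ Cu X m

/-- A cubespace: the composition axiom holds, and every map `{0,1}^0 → X` is a cube. -/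
structure IsCubespace (X : Type u) [CubeStructure X] : Prop where
  composition : CompositionAxiom X
  points : Cu X 0 = Set.univ

/-- A nilspace. In the completion axiom the `(n+1)`-corner is written as a map `q'` on the whole
of `{0,1}^(n+1)` whose value at `1^(n+1)` is irrelevant: the `n`-faces containing `0^(n+1)` are
the faces `{v | v i = 0}`, and none of them contains `1^(n+1)`. -/
structure IsNilspace (X : Type u) [CubeStructure X] : Prop where
  composition : CompositionAxiom X
  ergodicity : Cu X 1 = Set.univ
  completion : ∀ (n : ℕ) (q' : Vertex (n + 1) → X),
    (∀ i : Fin (n + 1), (fun w : Vertex n => q' (Fin.insertNth i false w)) ∈ Cu X n) →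
      ∃ q ∈ Cu X (n + 1), ∀ v : Vertex (n + 1), v ≠ (fun _ => true) → q v = q' v

/-- Isomorphism of cube structures (of nilspaces, in particular): a bijection which preserves
cubes in both directions. -/
def IsIsomorphic (Y : Type u) [CubeStructure Y] (Y' : Type v) [CubeStructure Y'] : Prop :=
  ∃ e : Y ≃ Y', ∀ (n : ℕ) (q : Vertex n → Y), q ∈ Cu Y n ↔ e ∘ q ∈ Cu Y' n

/-- `σ_n(g) = ∑_v (-1)^{|v|} g(v)`. -/
def sigma {Z : Type v} [AddCommGroup Z] {n : ℕ} (g : Vertex n → Z) : Z :=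
  ∑ v : Vertex n, (-1 : ℤ) ^ v.weight • g v

/-- The `n`-cubes of the degree-`k` structure `D_k(Z)` on an abelian group `Z`. -/
def degreeCubes (k : ℕ) (Z : Type v) [AddCommGroup Z] (n : ℕ) : Set (Vertex n → Z) :=
  {q | ∀ φ : Vertex (k + 1) → Vertex n, IsFaceMap φ → sigma (q ∘ φ) = 0}

/-- `π : B → S` is an abelian bundle over `S` with structure group `Z`: the action is free and
`s ↦ π⁻¹(s)` is a bijection from `S` to the set of orbits. -/
structure IsAbelianBundle (Z : Type v) [AddCommGroup Z] {B S : Type*} [AddAction Z B]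
    (π : B → S) : Prop where
  free : ∀ x : B, {z : Z | z +ᵥ x = x} = {0}
  fibres : Set.BijOn (fun s : S => π ⁻¹' {s}) Set.univ (Set.range fun x : B => AddAction.orbit Z x)

/-- `Y`, with the projection `π : Y → X` and the action of `Z`, is a degree-`k` extension
of `X`. -/
structure IsDegreeExtension (k : ℕ) (Z : Type v) [AddCommGroup Z] {X Y : Type*}
    [CubeStructure X] [CubeStructure Y] [AddAction Z Y] (π : Y → X) : Prop where
  bundle : IsAbelianBundle Z π
  cubespace : IsCubespace Y
  cubes_surj : ∀ n : ℕ, (fun q : Vertex n → Y => π ∘ q) '' Cu Y n = Cu X n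
  cubes_fibre : ∀ (n : ℕ), ∀ q₁ ∈ Cu Y n,
    {q₂ | q₂ ∈ Cu Y n ∧ π ∘ q₂ = π ∘ q₁} =
      {q₂ | ∃ q₃ ∈ degreeCubes k Z n, q₂ = fun v => q₃ v +ᵥ q₁ v}

/-- `q₁` is adjacent to `q₂`, and `q₃` is their concatenation. -/
def IsConcatenation {X : Type u} {n : ℕ} (q₁ q₂ q₃ : Vertex (n + 1) → X) : Prop :=
  (∀ w : Vertex n, q₁ (Fin.snoc w true) = q₂ (Fin.snoc w false)) ∧
  (∀ w : Vertex n, q₃ (Fin.snoc w false) = q₁ (Fin.snoc w false)) ∧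
  (∀ w : Vertex n, q₃ (Fin.snoc w true) = q₂ (Fin.snoc w true))

/-- A `Z`-valued cocycle of degree `k` on `X`. -/
structure IsCocycle {k : ℕ} {X : Type u} [CubeStructure X] {Z : Type v} [AddCommGroup Z]
    (ρ : Cu X (k + 1) → Z) : Prop where
  aut : ∀ (q q' : Cu X (k + 1)) (θ : Vertex (k + 1) → Vertex (k + 1)), IsCubeAut θ →
    q'.1 = q.1 ∘ θ → ρ q' = (-1 : ℤ) ^ reflections θ • ρ q
  concat : ∀ q₁ q₂ q₃ : Cu X (k + 1), IsConcatenation q₁.1 q₂.1 q₃.1 → ρ q₃ = ρ q₁ + ρ q₂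

/-- The group `Y_k(X,Z)` of cocycles of degree `k`, under pointwise addition. -/
def cocycles (k : ℕ) (X : Type u) [CubeStructure X] (Z : Type v) [AddCommGroup Z] :
    AddSubgroup (Cu X (k + 1) → Z) where
  carrier := {ρ | IsCocycle ρ}
  zero_mem' := ⟨fun _ _ _ _ _ => by simp, fun _ _ _ _ => by simp⟩
  add_mem' := fun {ρ ρ'} h h' =>
    ⟨fun q q' θ hθ hq => by
      simp only [Pi.add_apply, h.aut q q' θ hθ hq, h'.aut q q' θ hθ hq, smul_add],
    fun q₁ q₂ q₃ hq => by
      simp only [Pi.add_apply, h.concat q₁ q₂ q₃ hq, h'.concat q₁ q₂ q₃ hq]; abel⟩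
  neg_mem' := fun {ρ} h =>
    ⟨fun q q' θ hθ hq => by simp only [Pi.neg_apply, h.aut q q' θ hθ hq, smul_neg],
    fun q₁ q₂ q₃ hq => by simp only [Pi.neg_apply, h.concat q₁ q₂ q₃ hq]; abel⟩

/-- The homomorphism sending `f : X → Z` to the function `q ↦ σ_{k+1}(f ∘ q)`. -/
def coboundaryHom (k : ℕ) (X : Type u) [CubeStructure X] (Z : Type v) [AddCommGroup Z] :
    (X → Z) →+ (Cu X (k + 1) → Z) where
  toFun f := fun q => sigma (f ∘ q.1)
  map_zero' := by funext q; simp [sigma]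
  map_add' f g := by funext q; simp [sigma, Finset.sum_add_distrib]

/-- The subgroup of `Y_k(X,Z)` consisting of the coboundaries of degree `k`: the cocycles of the
form `q ↦ σ_{k+1}(f ∘ q)` with `f : X → Z`. -/
def coboundaries (k : ℕ) (X : Type u) [CubeStructure X] (Z : Type v) [AddCommGroup Z] :
    AddSubgroup (cocycles k X Z) :=
  (coboundaryHom k X Z).range.addSubgroupOf (cocycles k X Z)

/-- `H_k(X,Z)`: cocycles of degree `k` modulo coboundaries. -/
abbrev Cohomology (k : ℕ) (X : Type u) [CubeStructure X] (Z : Type v) [AddCommGroup Z] :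
    Type (max u v) :=
  cocycles k X Z ⧸ coboundaries k X Z

/-- The set `M(ρ) = ⋃_x {ρ_x + z : z ∈ Z}`, where `ρ_x` is the restriction of `ρ` to the set of
`(k+1)`-cubes `q` on `X` with `q(0^{k+1}) = x`. An element consists of the point `base = x` and
the function `fn = ρ_x + z`. -/
@[ext]
structure CocycleExt {k : ℕ} {X : Type u} [CubeStructure X] {Z : Type v} [AddCommGroup Z]
    (ρ : Cu X (k + 1) → Z) : Type (max u v) where
  base : X
  fn : {q : Cu X (k + 1) // q.1 (fun _ => false) = base} → Z
  mem : ∃ z : Z, ∀ c, fn c = ρ c.1 + z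

namespace CocycleExt

variable {k : ℕ} {X : Type u} [CubeStructure X] {Z : Type v} [AddCommGroup Z]

/-- The projection `ρ_x + z ↦ x`. -/
def proj (ρ : Cu X (k + 1) → Z) : CocycleExt ρ → X := CocycleExt.base

/-- The element `ρ_x`. -/
def origin (ρ : Cu X (k + 1) → Z) (x : X) : CocycleExt ρ :=
  ⟨x, fun c => ρ c.1, 0, fun _ => (add_zero _).symm⟩

/-- The action `(ρ_x + z, z') ↦ ρ_x + z + z'`. -/
instance (ρ : Cu X (k + 1) → Z) : AddAction Z (CocycleExt ρ) where
  vadd z' p := ⟨p.base, fun c => p.fn c + z', by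
    obtain ⟨z, hz⟩ := p.mem
    exact ⟨z + z', fun c => by rw [hz, add_assoc]⟩⟩
  zero_vadd p := by
    cases p
    simp [HVAdd.hVAdd]
  add_vadd a b p := by
    cases p
    simp only [HVAdd.hVAdd, CocycleExt.mk.injEq, heq_eq_eq, true_and]
    funext c
    abel

/-- The condition for `f` to be a `(k+1)`-cube on `M(ρ)`: the projection `proj ∘ f` is a cube on
`X`, and `ρ(proj ∘ f) = σ_{k+1}(a)`, where `a(v) = ρ_x - f(v)` with `x = proj(f(v))`. -/
def IsTopCube (ρ : Cu X (k + 1) → Z) (f : Vertex (k + 1) → CocycleExt ρ) : Prop :=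
  ∃ (h : proj ρ ∘ f ∈ Cu X (k + 1)) (a : Vertex (k + 1) → Z),
    (∀ v, a v +ᵥ f v = origin ρ (proj ρ (f v))) ∧ ρ ⟨proj ρ ∘ f, h⟩ = sigma a

/-- The cubes on `M(ρ)`: the maps `f` such that `proj ∘ f` is a cube on `X` and every face
restriction of `f` of dimension `k + 1` is a `(k+1)`-cube. (For `n = k + 1` the only such face
restriction is `f` itself.) -/
instance (ρ : Cu X (k + 1) → Z) : CubeStructure (CocycleExt ρ) where
  cu n := {f | proj ρ ∘ f ∈ Cu X n ∧
    ∀ φ : Vertex (k + 1) → Vertex n, IsStandardFaceMap φ → IsTopCube ρ (f ∘ φ)}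

end CocycleExt

/-- The degree-`k` extensions of `X` by `Z`. (Each of them is equinumerous with `X × Z`, so this
universe contains all of them up to isomorphism.) -/
structure DegreeExtension (k : ℕ) (X : Type u) [CubeStructure X] (Z : Type v)
    [AddCommGroup Z] where
  carrier : Type (max u v)
  [cubes : CubeStructure carrier]
  [action : AddAction Z carrier]
  proj : carrier → X
  isExtension : IsDegreeExtension k Z proj

attribute [instance] DegreeExtension.cubes DegreeExtension.action

/-- Two extensions are identified when their total spaces are isomorphic as cubespaces. -/
instance DegreeExtension.isoSetoid (k : ℕ) (X : Type u) [CubeStructure X] (Z : Type v)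
    [AddCommGroup Z] : Setoid (DegreeExtension k X Z) where
  r E E' := IsIsomorphic E.carrier E'.carrier
  iseqv :=
    { refl := fun _ => ⟨Equiv.refl _, fun _ _ => Iff.rfl⟩
      symm := by
        rintro E E' ⟨e, he⟩
        refine ⟨e.symm, fun n q => ?_⟩
        rw [he n (e.symm ∘ q), ← Function.comp_assoc, Equiv.self_comp_symm, Function.id_comp]
      trans := by
        rintro E E' E'' ⟨e, he⟩ ⟨e', he'⟩
        exact ⟨e.trans e', fun n q => (he n q).trans (he' n (e ∘ q))⟩ }

/-- The set of isomorphism classes of degree-`k` extensions of `X` by `Z`. -/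
abbrev ExtensionClass (k : ℕ) (X : Type u) [CubeStructure X] (Z : Type v) [AddCommGroup Z] :=
  Quotient (DegreeExtension.isoSetoid k X Z)

end CubeNil

namespace CubeNil

universe u v

/-! ### Morphisms and standard face maps of discrete cubes. -/

section CubeMorphisms

variable {l m n : ℕ}

/-! A choice of base point in every fibre identifies an extension with `X × Z`, and its cubes then
become the maps over cubes of `X` whose height `h` satisfies `σ(h ∘ f ∘ φ) = ρ(π ∘ f ∘ φ)` on all
standard `(k+1)`-faces `φ`. This is `IsTrivialization`. Two spaces trivialized by the same `ρ` are
isomorphic, and adding the coboundary of `f` to `ρ` only replaces `h` by `h + f ∘ π`. Since `M(ρ)`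
is trivialized by `ρ`, its isomorphism class depends only on the class of `ρ`.

That `M(ρ)` is an extension rests on cocycles of the discrete cube `{0,1}^n`, obtained by pulling
`ρ` back along a cube. Such a cocycle is determined by its values on standard face maps
(`eq_zero_of_standardFaceMap`), which makes the cubes stable under all morphisms, and it is a
coboundary (`exists_eq_sigma`), which lifts cubes of `X` to `M(ρ)`. Both are inductions on `n`:
splitting off the last coordinate leaves a cocycle on the bottom face and, one degree lower, a
cocycle on prisms.

For surjectivity, the value of `ρ` on a cube is read off as the alternating sum of heights of any
lift; the fibre axiom makes it independent of the lift. For additivity two adjacent cubes must be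
lifted compatibly, so they are first placed in one cube of one more dimension
(`exists_cube_of_concatAt`), by repeated completion in the nilspace `X`. -/

theorem Vertex.toInt_update (v : Vertex n) (i : Fin n) :
    Vertex.toInt (Function.update v i true) =
      Vertex.toInt (Function.update v i false) + Pi.single i 1 := by
  funext j
  by_cases h : j = i
  · subst h; simp [Vertex.toInt]
  · simp [Vertex.toInt, h]

/-- A map of discrete cubes is a morphism iff each coordinate is constant, a coordinate, or the
negation of a coordinate. -/
theorem isCubeMorphism_iff {φ : Vertex m → Vertex n} :
    IsCubeMorphism φ ↔
      ∀ j, (∃ b, ∀ v, φ v j = b) ∨ ∃ i b, ∀ v, φ v j = xor b (v i) := by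
  constructor
  · rintro ⟨L, t, hL⟩ j
    have hj : ∀ v, (φ v).toInt j = L v.toInt j + t j := fun v => congrFun (hL v) j
    have hval : ∀ v, (φ v).toInt j = if φ v j then 1 else 0 := fun v => rfl
    by_cases h : ∀ i, L (Pi.single i 1) j = 0
    · left
      have hl : (Pi.evalAddMonoidHom (fun _ : Fin n => ℤ) j).comp L = 0 := by
        refine AddMonoidHom.functions_ext _ _ _ fun i x => ?_
        have : Pi.single i x = x • (Pi.single i 1 : Fin m → ℤ) := by
          rw [← Pi.single_smul]; simp
        rw [this, map_zsmul]
        simp [h i]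
      have hl' : ∀ v, L v j = 0 := fun v => DFunLike.congr_fun hl v
      refine ⟨φ (fun _ => false) j, fun v => ?_⟩
      have h1 := hj v
      have h2 := hj (fun _ => false)
      rw [hl', hval, zero_add] at h1 h2
      cases hv : φ v j <;> cases hw : φ (fun _ => false) j <;> simp [hv, hw] at h1 h2 ⊢ <;> omega
    · right
      push Not at h
      obtain ⟨i, hi⟩ := h
      -- Flipping coordinate `i` changes a number in `{0,1}` by a fixed nonzero amount, so the sign
      -- of that amount and the value of `v i` already determine `φ v j`.
      have key : ∀ v : Vertex m, (if φ (Function.update v i true) j then (1 : ℤ) else 0) =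
          (if φ (Function.update v i false) j then 1 else 0) + L (Pi.single i 1) j := by
        intro v
        have h1 := hj (Function.update v i true)
        have h2 := hj (Function.update v i false)
        rw [hval] at h1 h2
        rw [Vertex.toInt_update, map_add, Pi.add_apply] at h1
        omega
      rcases lt_or_gt_of_ne hi with hneg | hpos
      · refine ⟨i, true, fun v => ?_⟩
        have := key v
        cases hv : v i
        · have e : Function.update v i false = v := by rw [← hv, Function.update_eq_self]
          rw [e] at this
          cases hw : φ v j
          · exfalso; simp only [hw, Bool.false_eq_true, if_false] at this; split_ifs at this <;> omega
          · rfl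
        · have e : Function.update v i true = v := by rw [← hv, Function.update_eq_self]
          rw [e] at this
          cases hw : φ v j
          · rfl
          · exfalso; simp only [hw, if_true] at this; split_ifs at this <;> omega
      · refine ⟨i, false, fun v => ?_⟩
        have := key v
        cases hv : v i
        · have e : Function.update v i false = v := by rw [← hv, Function.update_eq_self]
          rw [e] at this
          cases hw : φ v j
          · rfl
          · exfalso; simp only [hw, if_true] at this; split_ifs at this <;> omega
        · have e : Function.update v i true = v := by rw [← hv, Function.update_eq_self]
          rw [e] at this
          cases hw : φ v j
          · exfalso; simp only [hw, Bool.false_eq_true, if_false] at this; split_ifs at this <;> omega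
          · rfl
  · intro h
    have h' : ∀ j, ∃ (f : (Fin m → ℤ) →+ ℤ) (t : ℤ), ∀ v, (φ v).toInt j = f v.toInt + t := by
      intro j
      rcases h j with ⟨b, hb⟩ | ⟨i, b, hb⟩
      · exact ⟨0, if b then 1 else 0, fun v => by simp [Vertex.toInt, hb]⟩
      · cases b
        · exact ⟨Pi.evalAddMonoidHom _ i, 0, fun v => by simp [Vertex.toInt, hb]⟩
        · refine ⟨-Pi.evalAddMonoidHom _ i, 1, fun v => ?_⟩
          cases hv : v i <;> simp [Vertex.toInt, hb, hv]
    choose f t hf using h'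
    exact ⟨AddMonoidHom.mk' (fun v j => f j v) fun a b => by funext j; simp, t,
      fun v => funext fun j => hf j v⟩

theorem IsCubeMorphism.comp {φ : Vertex m → Vertex n} {ψ : Vertex l → Vertex m}
    (hφ : IsCubeMorphism φ) (hψ : IsCubeMorphism ψ) : IsCubeMorphism (φ ∘ ψ) := by
  obtain ⟨L, t, hL⟩ := hφ
  obtain ⟨L', t', hL'⟩ := hψ
  refine ⟨L.comp L', L t' + t, fun v => ?_⟩
  simp [hL, hL', add_assoc]

theorem isCubeMorphism_id : IsCubeMorphism (fun v : Vertex n => v) :=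
  isCubeMorphism_iff.2 fun j => .inr ⟨j, false, fun v => by simp⟩

theorem isCubeMorphism_const (x : Vertex n) : IsCubeMorphism (fun _ : Vertex m => x) :=
  isCubeMorphism_iff.2 fun j => .inl ⟨x j, fun _ => rfl⟩

theorem isCubeMorphism_reindex (f : Fin n → Fin m) :
    IsCubeMorphism (fun v : Vertex m => (v ∘ f : Vertex n)) :=
  isCubeMorphism_iff.2 fun j => .inr ⟨f j, false, fun v => by simp⟩

theorem isCubeMorphism_init : IsCubeMorphism (fun v : Vertex (n + 1) => (Fin.init v : Vertex n)) :=
  isCubeMorphism_reindex Fin.castSucc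

theorem isCubeMorphism_update (i : Fin n) (b : Bool) :
    IsCubeMorphism (fun v : Vertex n => Function.update v i b) := by
  refine isCubeMorphism_iff.2 fun j => ?_
  by_cases h : j = i
  · subst h; exact .inl ⟨b, fun v => by simp⟩
  · exact .inr ⟨j, false, fun v => by simp [h]⟩

theorem isCubeMorphism_insertNth (i : Fin (n + 1)) (b : Bool) :
    IsCubeMorphism (fun v : Vertex n => (Fin.insertNth i b v : Vertex (n + 1))) := by
  refine isCubeMorphism_iff.2 fun j => ?_
  induction j using Fin.succAboveCases i with
  | x => exact .inl ⟨b, fun v => by simp⟩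
  | p j => exact .inr ⟨j, false, fun v => by simp⟩

theorem isCubeMorphism_inf (u : Vertex n) : IsCubeMorphism (fun v : Vertex n => v ⊓ u) := by
  refine isCubeMorphism_iff.2 fun j => ?_
  cases h : u j
  · exact .inl ⟨false, fun v => by simp [h]⟩
  · exact .inr ⟨j, false, fun v => by simp [h]⟩

theorem IsCubeMorphism.snoc_const {φ : Vertex m → Vertex n} (hφ : IsCubeMorphism φ) (b : Bool) :
    IsCubeMorphism (fun v => (Fin.snoc (φ v) b : Vertex (n + 1))) := by
  refine isCubeMorphism_iff.2 fun j => ?_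
  induction j using Fin.lastCases with
  | last => exact .inl ⟨b, fun v => by simp⟩
  | cast j => simpa using isCubeMorphism_iff.1 hφ j

theorem IsCubeMorphism.snoc_xor {φ : Vertex m → Vertex n} (hφ : IsCubeMorphism φ) (b : Bool)
    (i : Fin m) : IsCubeMorphism (fun v => (Fin.snoc (φ v) (xor b (v i)) : Vertex (n + 1))) := by
  refine isCubeMorphism_iff.2 fun j => ?_
  induction j using Fin.lastCases with
  | last => exact .inr ⟨i, b, fun v => by simp⟩
  | cast j => simpa using isCubeMorphism_iff.1 hφ j

theorem IsCubeMorphism.snoc_var {φ : Vertex m → Vertex n} (hφ : IsCubeMorphism φ)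
    (i : Fin m) : IsCubeMorphism (fun v => (Fin.snoc (φ v) (v i) : Vertex (n + 1))) := by
  simpa using hφ.snoc_xor false i

theorem IsCubeMorphism.snoc_not {φ : Vertex m → Vertex n} (hφ : IsCubeMorphism φ)
    (i : Fin m) : IsCubeMorphism (fun v => (Fin.snoc (φ v) (!(v i)) : Vertex (n + 1))) := by
  simpa using hφ.snoc_xor true i

theorem IsStandardFaceMap.isFaceMap {φ : Vertex m → Vertex n} (h : IsStandardFaceMap φ) :
    IsFaceMap φ := by
  obtain ⟨e, x, hx⟩ := h
  refine ⟨isCubeMorphism_iff.2 fun j => ?_, fun v w hvw => ?_, (Finset.univ.map e.toEmbedding)ᶜ,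
    x, ?_, ?_⟩
  · by_cases hj : j ∈ Set.range e
    · obtain ⟨i, rfl⟩ := hj
      exact .inr ⟨i, false, fun v => by simp [(hx v).1]⟩
    · exact .inl ⟨x j, fun v => (hx v).2 j hj⟩
  · funext i
    rw [← (hx v).1, ← (hx w).1, hvw]
  · have := Finset.card_compl_add_card (Finset.univ.map e.toEmbedding)
    simpa using this
  · ext v
    simp only [Set.mem_range, Finset.mem_compl, Finset.mem_map, Finset.mem_univ, true_and,
      RelEmbedding.coe_toEmbedding, Set.mem_ofPred_eq]
    constructor
    · rintro ⟨w, rfl⟩ j hj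
      exact (hx w).2 j hj
    · intro hv
      refine ⟨v ∘ e, funext fun j => ?_⟩
      by_cases hj : j ∈ Set.range e
      · obtain ⟨i, rfl⟩ := hj
        exact (hx _).1 i
      · rw [(hx _).2 j hj, hv j hj]

theorem IsStandardFaceMap.isCubeMorphism {φ : Vertex m → Vertex n} (h : IsStandardFaceMap φ) :
    IsCubeMorphism φ := h.isFaceMap.1

theorem isStandardFaceMap_zero (φ : Vertex 0 → Vertex n) : IsStandardFaceMap φ :=
  ⟨(OrderEmbedding.ofIsEmpty : Fin 0 ↪o Fin n), φ default, fun v =>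
    ⟨fun i => i.elim0, fun j _ => by rw [Subsingleton.elim v default]⟩⟩

theorem IsStandardFaceMap.snoc_false {φ : Vertex m → Vertex n} (h : IsStandardFaceMap φ) :
    IsStandardFaceMap (fun v => (Fin.snoc (φ v) false : Vertex (n + 1))) := by
  obtain ⟨e, x, hx⟩ := h
  refine ⟨e.trans Fin.castSuccOrderEmb, Fin.snoc x false, fun v => ⟨fun i => ?_, fun j => ?_⟩⟩
  · simpa using (hx v).1 i
  · induction j using Fin.lastCases with
    | last => simp
    | cast j =>
      intro hj
      simpa using (hx v).2 j fun ⟨i, hi⟩ => hj ⟨i, by simp [hi]⟩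

/-- The product of a map of cubes with the identity of `{0,1}`. -/
def prism (φ : Vertex m → Vertex n) : Vertex (m + 1) → Vertex (n + 1) :=
  fun v => Fin.snoc (φ (Fin.init v)) (v (Fin.last m))

theorem IsCubeMorphism.prism {φ : Vertex m → Vertex n} (h : IsCubeMorphism φ) :
    IsCubeMorphism (prism φ) :=
  (h.comp isCubeMorphism_init).snoc_var (Fin.last m)

theorem IsStandardFaceMap.prism {φ : Vertex m → Vertex n} (h : IsStandardFaceMap φ) :
    IsStandardFaceMap (prism φ) := by
  obtain ⟨e, x, hx⟩ := h
  let e' : Fin (m + 1) → Fin (n + 1) := Fin.lastCases (Fin.last n) fun i => (e i).castSucc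
  have he' : StrictMono e' := by
    intro a b hab
    induction b using Fin.lastCases with
    | last =>
      induction a using Fin.lastCases with
      | last => exact absurd hab (lt_irrefl _)
      | cast a => simp [e', Fin.castSucc_lt_last]
    | cast b =>
      induction a using Fin.lastCases with
      | last => exact absurd (hab.trans (Fin.castSucc_lt_last b)) (lt_irrefl _)
      | cast a => simpa [e'] using hab
  refine ⟨OrderEmbedding.ofStrictMono e' he', Fin.snoc x false, fun v => ⟨fun i => ?_, fun j => ?_⟩⟩
  · induction i using Fin.lastCases with
    | last => simp [e', CubeNil.prism]
    | cast i =>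
      have := (hx (Fin.init v)).1 i
      simp only [e', CubeNil.prism, OrderEmbedding.coe_ofStrictMono, Fin.lastCases_castSucc, Fin.snoc_castSucc, this]
      rfl
  · induction j using Fin.lastCases with
    | last => exact fun hj => absurd ⟨Fin.last m, by simp [e']⟩ hj
    | cast j =>
      intro hj
      simpa [CubeNil.prism] using (hx _).2 j fun ⟨i, hi⟩ => hj ⟨i.castSucc, by simp [e', hi]⟩

end CubeMorphisms

/-! ### Alternating sums and automorphisms. -/

section Sigma

variable {Z : Type v} [AddCommGroup Z] {m n : ℕ}

theorem neg_one_pow_weight (v : Vertex n) :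
    (-1 : ℤ) ^ v.weight = ∏ i, if v i then -1 else 1 := by
  simp [Vertex.weight, Finset.prod_ite]

theorem sigma_zero (g : Vertex 0 → Z) : sigma g = g default := by
  simp only [sigma, neg_one_pow_weight, Fintype.sum_unique]
  simp only [Finset.univ_eq_empty, Finset.prod_empty, one_smul]
  exact congrArg g (Subsingleton.elim _ _)

theorem sigma_insertNth (i : Fin (n + 1)) (g : Vertex (n + 1) → Z) :
    sigma g = sigma (fun w : Vertex n => g (Fin.insertNth i false w)) -
      sigma (fun w : Vertex n => g (Fin.insertNth i true w)) := by
  simp only [sigma, neg_one_pow_weight]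
  rw [← (Fin.insertNthEquiv (fun _ => Bool) i).sum_comp, Fintype.sum_prod_type, Fintype.sum_bool]
  simp only [Fin.insertNthEquiv_apply, Fin.prod_univ_succAbove _ i, Fin.insertNth_apply_same,
    Fin.insertNth_apply_succAbove]
  simp [sub_eq_neg_add]
  rfl

theorem sigma_snoc (g : Vertex (n + 1) → Z) :
    sigma g = sigma (fun w : Vertex n => g (Fin.snoc w false)) -
      sigma (fun w : Vertex n => g (Fin.snoc w true)) := by
  simpa [Fin.insertNth_last'] using sigma_insertNth (Fin.last n) g

theorem sigma_add (f g : Vertex n → Z) : sigma (f + g) = sigma f + sigma g := by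
  simp [sigma, Finset.sum_add_distrib]

theorem sigma_sub (f g : Vertex n → Z) : sigma (f - g) = sigma f - sigma g := by
  simp [sigma, smul_sub, Finset.sum_sub_distrib]

/-- An automorphism of the discrete cube permutes and reflects the coordinates. -/
theorem IsCubeAut.exists_perm {θ : Vertex n → Vertex n} (hθ : IsCubeAut θ) :
    ∃ f : Fin n → Fin n, Function.Bijective f ∧ ∃ b : Vertex n, ∀ v j,
      θ v j = xor (b j) (v (f j)) := by
  have h := isCubeMorphism_iff.1 hθ.1
  have h' : ∀ j, ∃ i b, ∀ v, θ v j = xor b (v i) := by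
    intro j
    rcases h j with ⟨b, hb⟩ | h
    · obtain ⟨v, hv⟩ := hθ.2.2 fun _ => !b
      have := hb v
      rw [hv] at this
      simp at this
    · exact h
  choose f b hf using h'
  refine ⟨f, Finite.injective_iff_bijective.1 fun j j' hj => ?_, b, fun v j => hf j v⟩
  -- If `f j = f j'`, the exclusive or of the outputs `j` and `j'` is constant. The target vertex
  -- chosen here violates this, against surjectivity.
  by_contra hne
  obtain ⟨v, hv⟩ := hθ.2.2 (Function.update b j (!b j))
  have h1 := hf j v
  have h2 := hf j' v
  rw [hv] at h1 h2
  rw [Function.update_of_ne (Ne.symm hne), ← hj] at h2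
  rw [Function.update_self] at h1
  cases hb : b j <;> cases hb' : b j' <;> cases hv' : v (f j) <;> simp_all

/-- The sign `(-1)^|v|` is a product over coordinates: permuting them does not change it, and each
reflected coordinate contributes a factor `-1`. -/
theorem sigma_comp_aut {θ : Vertex n → Vertex n} (hθ : IsCubeAut θ) (g : Vertex n → Z) :
    sigma (g ∘ θ) = (-1 : ℤ) ^ reflections θ • sigma g := by
  obtain ⟨f, hf, b, hb⟩ := hθ.exists_perm
  have hsign : ∀ v, (-1 : ℤ) ^ v.weight = (-1) ^ reflections θ * (-1) ^ (θ v).weight := by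
    intro v
    have h1 : ∏ i, (if v i then (-1 : ℤ) else 1) = ∏ i, if v (f i) then (-1 : ℤ) else 1 :=
      ((Equiv.ofBijective f hf).prod_comp fun i => if v i then (-1 : ℤ) else 1).symm
    rw [reflections, neg_one_pow_weight, neg_one_pow_weight, neg_one_pow_weight, h1,
      ← Finset.prod_mul_distrib]
    refine Finset.prod_congr rfl fun i _ => ?_
    cases hbi : b i <;> cases hv : v (f i) <;> simp [hb, hbi, hv]
  rw [sigma, sigma, ← (Equiv.ofBijective θ hθ.2).sum_comp fun v => (-1 : ℤ) ^ v.weight • g v, Finset.smul_sum]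
  refine Finset.sum_congr rfl fun v _ => ?_
  rw [hsign v, mul_smul]
  rfl

theorem isCubeAut_reindex {f : Fin n → Fin n} (hf : Function.Injective f) :
    IsCubeAut (fun v : Vertex n => (v ∘ f : Vertex n)) := by
  refine ⟨isCubeMorphism_reindex f, Finite.injective_iff_bijective.1 fun v w h => ?_⟩
  exact (Finite.injective_iff_surjective.1 hf).injective_comp_right h

theorem reflections_reindex (f : Fin n → Fin n) :
    reflections (fun v : Vertex n => (v ∘ f : Vertex n)) = 0 := by
  simp [reflections, Vertex.weight]

end Sigma

/-! ### Cocycles on the discrete cube. -/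

section CubeCocycles

variable {Z : Type v} [AddCommGroup Z] {s n : ℕ}

/-- `g₃` is the concatenation of `g₁` and `g₂` along the coordinate `i`. -/
def ConcatAt {α : Type*} (i : Fin s) (g₁ g₂ g₃ : Vertex s → α) : Prop :=
  ∀ v, g₁ (Function.update v i true) = g₂ (Function.update v i false) ∧
    g₃ (Function.update v i false) = g₁ (Function.update v i false) ∧
    g₃ (Function.update v i true) = g₂ (Function.update v i true)

theorem ConcatAt.comp_left {α β : Type*} {i : Fin s} {g₁ g₂ g₃ : Vertex s → α}
    (h : ConcatAt i g₁ g₂ g₃) (f : α → β) : ConcatAt i (f ∘ g₁) (f ∘ g₂) (f ∘ g₃) :=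
  fun v => ⟨congrArg f (h v).1, congrArg f (h v).2.1, congrArg f (h v).2.2⟩

/-- A cocycle on the discrete cube `{0,1}^n`, as a function on all maps into it of which only the
values at morphisms matter: it is invariant under permutations of the coordinates and additive
under concatenation along any coordinate. -/
structure IsCubeCocycle (B : (Vertex s → Vertex n) → Z) : Prop where
  perm : ∀ φ, IsCubeMorphism φ → ∀ f : Fin s → Fin s, Function.Injective f →
    B (fun v => φ (v ∘ f)) = B φ
  concat : ∀ i φ₁ φ₂ φ₃, IsCubeMorphism φ₁ → IsCubeMorphism φ₂ → IsCubeMorphism φ₃ →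
    ConcatAt i φ₁ φ₂ φ₃ → B φ₃ = B φ₁ + B φ₂

namespace IsCubeCocycle

theorem sub {B B' : (Vertex s → Vertex n) → Z} (h : IsCubeCocycle B) (h' : IsCubeCocycle B') :
    IsCubeCocycle (B - B') where
  perm φ hφ f hf := by simp only [Pi.sub_apply, h.perm φ hφ f hf, h'.perm φ hφ f hf]
  concat i φ₁ φ₂ φ₃ h₁ h₂ h₃ hc := by
    simp only [Pi.sub_apply, h.concat i _ _ _ h₁ h₂ h₃ hc, h'.concat i _ _ _ h₁ h₂ h₃ hc]
    abel

/-- A map that ignores a coordinate is its own concatenation with itself, so `B φ = B φ + B φ`. -/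
theorem eq_zero_of_degenerate {B : (Vertex s → Vertex n) → Z} (h : IsCubeCocycle B) (i : Fin s)
    {φ : Vertex s → Vertex n} (hφ : IsCubeMorphism φ)
    (hi : ∀ v, φ (Function.update v i true) = φ (Function.update v i false)) : B φ = 0 := by
  have := h.concat i φ φ φ hφ hφ hφ fun v => ⟨hi v, rfl, rfl⟩
  simpa using this

theorem level {B : (Vertex s → Vertex (n + 1)) → Z} (h : IsCubeCocycle B) :
    IsCubeCocycle fun φ : Vertex s → Vertex n => B fun v => Fin.snoc (φ v) false where
  perm _ hφ f hf := h.perm _ (hφ.snoc_const false) f hf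
  concat i _ _ _ h₁ h₂ h₃ hc :=
    h.concat i _ _ _ (h₁.snoc_const _) (h₂.snoc_const _) (h₃.snoc_const _)
      (hc.comp_left fun w => (Fin.snoc w false : Vertex (n + 1)))

theorem prism {B : (Vertex (s + 1) → Vertex (n + 1)) → Z} (h : IsCubeCocycle B) :
    IsCubeCocycle fun φ : Vertex s → Vertex n => B (CubeNil.prism φ) where
  perm φ hφ f hf := by
    let f' : Fin (s + 1) → Fin (s + 1) := Fin.lastCases (Fin.last s) fun i => (f i).castSucc
    have hf' : Function.Injective f' := by
      intro a b hab
      induction b using Fin.lastCases with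
      | last =>
        induction a using Fin.lastCases with
        | last => rfl
        | cast a => simp [f', (Fin.castSucc_lt_last _).ne] at hab
      | cast b =>
        induction a using Fin.lastCases with
        | last => simp [f', (Fin.castSucc_lt_last _).ne'] at hab
        | cast a =>
          simp only [f', Fin.lastCases_castSucc, Fin.castSucc_inj] at hab
          rw [hf hab]
    rw [← h.perm _ hφ.prism f' hf']
    congr 1
    funext v
    have h1 : (Fin.init (v ∘ f') : Vertex s) = (Fin.init v : Vertex s) ∘ f := by
      funext i; simp [Fin.init, f']
    simp only [CubeNil.prism]
    rw [h1]
    simp [f']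
  concat i φ₁ φ₂ φ₃ h₁ h₂ h₃ hc := by
    refine h.concat i.castSucc _ _ _ h₁.prism h₂.prism h₃.prism fun v => ?_
    have hne : Fin.last s ≠ i.castSucc := (Fin.castSucc_lt_last i).ne'
    have hc' := hc (Fin.init v)
    simp only [CubeNil.prism, Fin.init_update_castSucc, Function.update_of_ne hne]
    rw [hc'.1, hc'.2.1, hc'.2.2]
    exact ⟨rfl, rfl, rfl⟩

/-- The last output of a morphism is constant, an input coordinate or a negated one. In each case
concatenation reduces the map to maps into the bottom face and to prisms. This is the inductive step
of both main results on cube cocycles. -/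
theorem eq_zero_of_level_of_prism {B : (Vertex (s + 1) → Vertex (n + 1)) → Z}
    (h : IsCubeCocycle B)
    (h0 : ∀ φ : Vertex (s + 1) → Vertex n, IsCubeMorphism φ → B (fun v => Fin.snoc (φ v) false) = 0)
    (h1 : ∀ φ : Vertex s → Vertex n, IsCubeMorphism φ → B (CubeNil.prism φ) = 0)
    (φ : Vertex (s + 1) → Vertex (n + 1)) (hφ : IsCubeMorphism φ) : B φ = 0 := by
  -- products with an interval in an arbitrary coordinate
  have hprism : ∀ (i : Fin (s + 1)) (b : Bool) (χ : Vertex (s + 1) → Vertex n), IsCubeMorphism χ →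
      B (fun v => Fin.snoc (χ (Function.update v i b)) (v i)) = 0 := by
    intro i b χ hχ
    have hm : IsCubeMorphism
        (fun v => (Fin.snoc (χ (Function.update v i b)) (v i) : Vertex (n + 1))) :=
      (hχ.comp (isCubeMorphism_update i b)).snoc_var i
    rw [← h.perm _ hm _ (Equiv.swap i (Fin.last s)).injective]
    have hm' : IsCubeMorphism fun w : Vertex s => χ (Function.update
        ((Fin.snoc w false : Vertex (s + 1)) ∘ Equiv.swap i (Fin.last s)) i b) :=
      hχ.comp <| (isCubeMorphism_update i b).comp <|
        (isCubeMorphism_reindex (Equiv.swap i (Fin.last s))).comp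
          (isCubeMorphism_id.snoc_const false)
    rw [← h1 _ hm']
    congr 1
    funext v
    simp only [CubeNil.prism, Function.comp_apply, Equiv.swap_apply_left]
    congr 2
    funext j
    by_cases hj : j = i
    · subst hj; simp
    · rw [Function.update_of_ne hj, Function.update_of_ne hj, Function.comp_apply,
        Function.comp_apply]
      have : Equiv.swap i (Fin.last s) j ≠ Fin.last s := by
        intro hh
        rw [Equiv.swap_apply_eq_iff, Equiv.swap_apply_right] at hh
        exact hj hh
      obtain ⟨j', hj'⟩ := Fin.exists_castSucc_eq.2 this
      rw [← hj']
      simp [Fin.init]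
  -- Along coordinate `i`, first move with `χ` at height `0`, then rise with `χ` frozen at its
  -- endpoint.
  have hdiag : ∀ (i : Fin (s + 1)) (χ : Vertex (s + 1) → Vertex n), IsCubeMorphism χ →
      B (fun v => Fin.snoc (χ v) (v i)) = 0 := by
    intro i χ hχ
    rw [h.concat i (fun v => Fin.snoc (χ v) false)
      (fun v => Fin.snoc (χ (Function.update v i true)) (v i)) _ (hχ.snoc_const _)
      ((hχ.comp (isCubeMorphism_update i true)).snoc_var i) (hχ.snoc_var i) (fun v => by simp),
      h0 χ hχ, hprism i true χ hχ, add_zero]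
  -- Going up and then down again concatenates to a map into the bottom face, so the downward prism
  -- vanishes too. No reflection axiom is needed.
  have hprism' : ∀ (i : Fin (s + 1)) (b : Bool) (χ : Vertex (s + 1) → Vertex n),
      IsCubeMorphism χ → B (fun v => Fin.snoc (χ (Function.update v i b)) (!(v i))) = 0 := by
    intro i b χ hχ
    have hχ' := hχ.comp (isCubeMorphism_update i b)
    have := h.concat i (fun v => Fin.snoc (χ (Function.update v i b)) (v i))
      (fun v => Fin.snoc (χ (Function.update v i b)) (!(v i)))
      (fun v => Fin.snoc (χ (Function.update v i b)) false)
      (hχ'.snoc_var i) (hχ'.snoc_not i) (hχ'.snoc_const false) (fun v => by simp)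
    rw [hprism i b χ hχ, zero_add] at this
    exact this.symm.trans (h0 _ hχ')
  have hanti : ∀ (i : Fin (s + 1)) (χ : Vertex (s + 1) → Vertex n), IsCubeMorphism χ →
      B (fun v => Fin.snoc (χ v) (!(v i))) = 0 := by
    intro i χ hχ
    rw [h.concat i (fun v => Fin.snoc (χ (Function.update v i false)) (!(v i)))
      (fun v => Fin.snoc (χ v) false) _ ((hχ.comp (isCubeMorphism_update i false)).snoc_not i)
      (hχ.snoc_const _) (hχ.snoc_not i) (fun v => by simp),
      h0 χ hχ, hprism' i false χ hχ, add_zero]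
  have hinit : IsCubeMorphism fun v => (Fin.init (φ v) : Vertex n) := isCubeMorphism_init.comp hφ
  rcases isCubeMorphism_iff.1 hφ (Fin.last n) with ⟨b, hb⟩ | ⟨i, b, hb⟩
  · have hφ' : φ = fun v => Fin.snoc (Fin.init (φ v)) b := by
      funext v; rw [← hb v, Fin.snoc_init_self]
    rw [hφ']
    cases b
    · exact h0 _ hinit
    -- A map at height `1` is split as a descent to height `0` followed by an ascent.
    · rw [h.concat (Fin.last s) (fun v => Fin.snoc (Fin.init (φ v)) (!(v (Fin.last s))))
        (fun v => Fin.snoc (Fin.init (φ (Function.update v (Fin.last s) true))) (v (Fin.last s))) _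
        (hinit.snoc_not _) ((hinit.comp (isCubeMorphism_update _ true)).snoc_var _)
        (hinit.snoc_const true) (fun v => by simp), hanti _ _ hinit,
        hprism (Fin.last s) true (fun v => Fin.init (φ v)) hinit, add_zero]
  · have hφ' : φ = fun v => Fin.snoc (Fin.init (φ v)) (xor b (v i)) := by
      funext v; rw [← hb v, Fin.snoc_init_self]
    rw [hφ']
    cases b
    · simpa using hdiag i _ hinit
    · simpa using hanti i _ hinit

/-- A cocycle on the discrete cube which vanishes on the standard face maps is zero. -/
theorem eq_zero_of_standardFaceMap {B : (Vertex s → Vertex n) → Z} (h : IsCubeCocycle B)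
    (hB : ∀ φ, IsStandardFaceMap φ → B φ = 0) (φ : Vertex s → Vertex n) (hφ : IsCubeMorphism φ) :
    B φ = 0 := by
  induction n generalizing s with
  | zero =>
    cases s with
    | zero => exact hB φ (isStandardFaceMap_zero φ)
    | succ s => exact h.eq_zero_of_degenerate 0 hφ fun v => Subsingleton.elim _ _
  | succ n ih =>
    cases s with
    | zero => exact hB φ (isStandardFaceMap_zero φ)
    | succ s =>
      exact h.eq_zero_of_level_of_prism (fun ψ hψ => ih h.level (fun χ hχ => hB _ hχ.snoc_false) ψ hψ)
        (fun ψ hψ => ih h.prism (fun χ hχ => hB _ hχ.prism) ψ hψ) φ hφ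

end IsCubeCocycle

/-- The shared face enters the two sums with opposite signs and cancels. -/
theorem sigma_concatAt {i : Fin s} {g₁ g₂ g₃ : Vertex s → Z} (h : ConcatAt i g₁ g₂ g₃) :
    sigma g₃ = sigma g₁ + sigma g₂ := by
  cases s with
  | zero => exact i.elim0
  | succ s =>
    have h' : ∀ w : Vertex s,
        g₁ (Fin.insertNth i true w) = g₂ (Fin.insertNth i false w) ∧
        g₃ (Fin.insertNth i false w) = g₁ (Fin.insertNth i false w) ∧
        g₃ (Fin.insertNth i true w) = g₂ (Fin.insertNth i true w) := fun w => by
      simpa using h (Fin.insertNth i false w)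
    simp only [sigma_insertNth i, fun w => (h' w).1, fun w => (h' w).2.1, fun w => (h' w).2.2]
    abel

theorem isCubeCocycle_sigma (a : Vertex n → Z) :
    IsCubeCocycle fun φ : Vertex s → Vertex n => sigma (a ∘ φ) where
  perm φ _ f hf := by
    have := sigma_comp_aut (isCubeAut_reindex hf) (a ∘ φ)
    rw [reflections_reindex, pow_zero, one_smul] at this
    exact this
  concat _ _ _ _ _ _ _ hc := sigma_concatAt (hc.comp_left a)

/-- Every cocycle on the discrete cube is a coboundary. -/
theorem IsCubeCocycle.exists_eq_sigma {B : (Vertex s → Vertex n) → Z} (h : IsCubeCocycle B) :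
    ∃ a : Vertex n → Z, ∀ φ, IsCubeMorphism φ → B φ = sigma (a ∘ φ) := by
  induction n generalizing s with
  | zero =>
    cases s with
    | zero =>
      refine ⟨fun v => B fun _ => v, fun φ _ => ?_⟩
      rw [sigma_zero]
      exact congrArg B (Subsingleton.elim _ _)
    | succ s =>
      refine ⟨0, fun φ hφ => ?_⟩
      rw [h.eq_zero_of_degenerate 0 hφ fun v => Subsingleton.elim _ _]
      simp [sigma]
  | succ n ih =>
    cases s with
    | zero =>
      refine ⟨fun v => B fun _ => v, fun φ _ => ?_⟩
      rw [sigma_zero]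
      congr 1
      funext v
      rw [Subsingleton.elim v default]
    | succ s =>
      obtain ⟨a, ha⟩ := ih h.level
      obtain ⟨d, hd⟩ := ih h.prism
      -- On a prism the alternating sum is that of the bottom minus that of the top. It must equal
      -- the sum of `d`, so the top values are forced to be `a - d`, up to functions with zero sums.
      let a' : Vertex (n + 1) → Z := fun v =>
        if v (Fin.last n) then a (Fin.init v) - d (Fin.init v) else a (Fin.init v)
      refine ⟨a', fun φ hφ => sub_eq_zero.1 ?_⟩
      refine (h.sub (isCubeCocycle_sigma a')).eq_zero_of_level_of_prism (fun ψ hψ => ?_)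
        (fun ψ hψ => ?_) φ hφ
      · rw [Pi.sub_apply, ha ψ hψ, sub_eq_zero]
        congr 1
        funext v
        simp [a']
      · rw [Pi.sub_apply, hd ψ hψ, sub_eq_zero, sigma_snoc, ← sigma_sub]
        congr 1
        funext v
        simp [a', CubeNil.prism]

end CubeCocycles

section DegreeCubes

variable {Z : Type v} [AddCommGroup Z] {k n : ℕ}

/-- Since `φ ↦ σ(g ∘ φ)` is a cube cocycle, reflected and permuted faces impose no further
conditions. -/
theorem mem_degreeCubes_iff {g : Vertex n → Z} :
    g ∈ degreeCubes k Z n ↔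
      ∀ φ : Vertex (k + 1) → Vertex n, IsStandardFaceMap φ → sigma (g ∘ φ) = 0 :=
  ⟨fun h φ hφ => h φ hφ.isFaceMap, fun h φ hφ =>
    (isCubeCocycle_sigma g).eq_zero_of_standardFaceMap h φ hφ.1⟩

end DegreeCubes

/-! ### Completing partial cubes in a nilspace. -/

section Nilspace

variable {X : Type u} [CubeStructure X]

theorem CompositionAxiom.const_mem (hX : CompositionAxiom X) {m : ℕ} {q : Vertex m → X}
    (hq : q ∈ Cu X m) (n : ℕ) (v : Vertex m) : (fun _ => q v) ∈ Cu X n :=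
  hX n m _ (isCubeMorphism_const v) q hq

theorem IsNilspace.const_mem (hX : IsNilspace X) (n : ℕ) (x : X) : (fun _ => x) ∈ Cu X n :=
  hX.composition.const_mem (m := 1) (q := fun _ => x) (hX.ergodicity ▸ Set.mem_univ _) n default

/-- One step of the completion of a partial cube: a new vertex is added to its lower set of
definition. -/
theorem IsNilspace.exists_update (hX : IsNilspace X) {N : ℕ} (F : Vertex N → X) (v : Vertex N)
    (hF : ∀ u < v, (fun w => F (w ⊓ u)) ∈ Cu X N) :
    ∃ x, (fun w => Function.update F v x (w ⊓ v)) ∈ Cu X N := by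
  obtain ⟨m, e⟩ : ∃ m, Nonempty (Fin m ≃ {i // v i = true}) :=
    ⟨_, ⟨(Fintype.equivFin {i // v i = true}).symm⟩⟩
  obtain ⟨e⟩ := e
  cases m with
  -- Completion starts in dimension one, so the bottom vertex is treated by a constant cube.
  | zero =>
    have hv : v = ⊥ := by
      funext i
      cases hi : v i
      · rfl
      · exact (e.symm ⟨i, hi⟩).elim0
    refine ⟨F v, ?_⟩
    subst hv
    simpa using hX.const_mem N (F ⊥)
  | succ m =>
    -- The box below `v` is a cube of dimension `|v|`: `φ` embeds it and `ψ` retracts onto it. Its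
    -- faces through the origin are the boxes below `v` with one coordinate switched off, so `F`
    -- restricts to a corner.
    let φ : Vertex (m + 1) → Vertex N := fun w i =>
      if h : v i = true then w (e.symm ⟨i, h⟩) else false
    let ψ : Vertex N → Vertex (m + 1) := fun u => u ∘ fun i => (e i).1
    have hφ : IsCubeMorphism φ := by
      refine isCubeMorphism_iff.2 fun i => ?_
      by_cases h : v i = true
      · exact .inr ⟨e.symm ⟨i, h⟩, false, fun w => by simp [φ, h]⟩
      · exact .inl ⟨false, fun w => by simp [φ, h]⟩
    have hψ : IsCubeMorphism ψ := isCubeMorphism_reindex _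
    have hφψ : ∀ u, φ (ψ u) = u ⊓ v := by
      intro u
      funext i
      cases h : v i <;> simp [φ, ψ, h]
    obtain ⟨q, hq, hqF⟩ := hX.completion m (F ∘ φ) (by
      intro i
      let u : Vertex N := Function.update v (e i) false
      have hu : u < v := by
        refine lt_of_le_of_ne (update_le_self_iff.2 (Bool.false_le _)) fun h => ?_
        have := congrFun h (e i).1
        rw [(e i).2] at this
        simp [u] at this
      have := hX.composition _ _ _ (hφ.comp (isCubeMorphism_insertNth i false)) _ (hF u hu)
      convert this using 1
      funext w
      simp only [Function.comp_apply]
      congr 1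
      funext j
      by_cases hj : j = (e i).1
      · subst hj
        simp [φ, u, (e i).2]
      · cases h : v j <;> simp [φ, u, hj, h])
    refine ⟨q fun _ => true, ?_⟩
    have := hX.composition _ _ _ hψ q hq
    convert this using 1
    funext w
    rw [Function.comp_apply]
    by_cases hw : w ⊓ v = v
    · rw [hw, Function.update_self]
      congr 1
      funext i
      have := congrFun hw (e i).1
      simpa [(e i).2, ψ] using this.symm
    · rw [Function.update_of_ne hw, hqF, Function.comp_apply, hφψ]
      intro h
      apply hw
      rw [← hφψ, h]
      funext i
      cases hi : v i <;> simp [φ, hi]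

/-- A map which restricts to cubes on the boxes spanned by the elements of a lower set of vertices
agrees with a cube on that lower set. -/
theorem IsNilspace.exists_extension (hX : IsNilspace X) {N : ℕ} (P : Finset (Vertex N))
    (hP : IsLowerSet (P : Set (Vertex N))) (F : Vertex N → X)
    (hF : ∀ u ∈ P, (fun w => F (w ⊓ u)) ∈ Cu X N) : ∃ Q ∈ Cu X N, ∀ u ∈ P, Q u = F u := by
  induction hc : Pᶜ.card using Nat.strong_induction_on generalizing P F with
  | _ c ih =>
    rcases Pᶜ.eq_empty_or_nonempty with hemp | hne
    · have htop : (⊤ : Vertex N) ∈ P := by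
        rw [Finset.compl_eq_empty_iff] at hemp
        simp [hemp]
      exact ⟨F, by simpa using hF ⊤ htop, fun _ _ => rfl⟩
    -- Minimality puts everything strictly below `v` in `P`, so a single completion defines the
    -- value at `v`.
    · obtain ⟨v, hv⟩ := Pᶜ.exists_minimal hne
      have hvP : v ∉ P := Finset.mem_compl.1 hv.1
      have hlt : ∀ u < v, u ∈ P := fun u hu => by
        by_contra h
        exact absurd (hv.2 (Finset.mem_compl.2 h) hu.le) (not_le_of_gt hu)
      obtain ⟨x, hx⟩ := hX.exists_update F v fun u hu => hF u (hlt u hu)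
      obtain ⟨Q, hQ, hQF⟩ := ih _ (by
        rw [← hc]
        exact Finset.card_lt_card (Finset.compl_ssubset_compl.2 (Finset.ssubset_insert hvP)))
        (insert v P) (by
          intro a b hba ha
          rw [Finset.mem_coe, Finset.mem_insert] at ha ⊢
          rcases ha with rfl | ha
          · rcases hba.eq_or_lt with h | h
            · exact .inl h
            · exact .inr (hlt b h)
          · exact .inr (hP hba ha))
        (Function.update F v x) (by
          intro u hu
          rcases Finset.mem_insert.1 hu with rfl | hu
          · exact hx
          · convert hF u hu using 2 with w
            exact Function.update_of_ne (fun h => hvP (by rw [← h]; exact hP inf_le_right hu)) _ _) rfl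
      refine ⟨Q, hQ, fun u hu => ?_⟩
      rw [hQF u (Finset.mem_insert_of_mem hu), Function.update_of_ne fun h => hvP (by rwa [← h])]

/-- Two adjacent cubes and their concatenation are obtained from one cube of dimension one
higher. -/
theorem IsNilspace.exists_cube_of_concatAt (hX : IsNilspace X) {n : ℕ}
    {q₁ q₂ q₃ : Vertex (n + 1) → X} (h₁ : q₁ ∈ Cu X (n + 1)) (h₂ : q₂ ∈ Cu X (n + 1))
    (h : ConcatAt (Fin.last n) q₁ q₂ q₃) :
    ∃ Q ∈ Cu X (n + 2), ∃ φ₁ φ₂ φ₃ : Vertex (n + 1) → Vertex (n + 2),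
      IsCubeMorphism φ₁ ∧ IsCubeMorphism φ₂ ∧ IsCubeMorphism φ₃ ∧
      ConcatAt (Fin.last n) φ₁ φ₂ φ₃ ∧ Q ∘ φ₁ = q₁ ∧ Q ∘ φ₂ = q₂ ∧ Q ∘ φ₃ = q₃ := by
  let t : Fin (n + 2) := Fin.last (n + 1)
  let s : Fin (n + 2) := (Fin.last n).castSucc
  have hinit : IsCubeMorphism fun v : Vertex (n + 1) => (Fin.init v : Vertex n) :=
    isCubeMorphism_init
  -- In the `(s, t)` square, `φ₁` runs from `(1,0)` to `(0,0)`, `φ₂` from `(0,0)` to `(0,1)`, and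
  -- `φ₃` directly from `(1,0)` to `(0,1)`. Reversing `q₁` puts the common face at the origin, so
  -- the data live on the lower set `t = 0` or `s = 0`.
  let φ₁ : Vertex (n + 1) → Vertex (n + 2) := fun v =>
    Fin.snoc (Fin.snoc (Fin.init v : Vertex n) (!(v (Fin.last n))) : Vertex (n + 1)) false
  let φ₂ : Vertex (n + 1) → Vertex (n + 2) := fun v =>
    Fin.snoc (Fin.snoc (Fin.init v : Vertex n) false : Vertex (n + 1)) (v (Fin.last n))
  let φ₃ : Vertex (n + 1) → Vertex (n + 2) := fun v =>
    Fin.snoc (Fin.snoc (Fin.init v : Vertex n) (!(v (Fin.last n))) : Vertex (n + 1))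
      (v (Fin.last n))
  let ψ₁ : Vertex (n + 2) → Vertex (n + 1) := fun u =>
    Fin.snoc (Fin.init (Fin.init u : Vertex (n + 1)) : Vertex n) (!(u s))
  let ψ₂ : Vertex (n + 2) → Vertex (n + 1) := fun u =>
    Fin.snoc (Fin.init (Fin.init u : Vertex (n + 1)) : Vertex n) (u t)
  have hinit2 : IsCubeMorphism fun u : Vertex (n + 2) =>
      (Fin.init (Fin.init u : Vertex (n + 1)) : Vertex n) :=
    isCubeMorphism_init.comp isCubeMorphism_init
  have hψ₁ : IsCubeMorphism ψ₁ := hinit2.snoc_not s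
  have hψ₂ : IsCubeMorphism ψ₂ := hinit2.snoc_var t
  let P : Finset (Vertex (n + 2)) := Finset.univ.filter fun u => u t = false ∨ u s = false
  let F : Vertex (n + 2) → X := fun u => if u t = false then q₁ (ψ₁ u) else q₂ (ψ₂ u)
  have hF₂ : ∀ u : Vertex (n + 2), u s = false → F u = q₂ (ψ₂ u) := by
    intro u hu
    by_cases ht : u t = false
    · have := (h (Fin.snoc (Fin.init (Fin.init u : Vertex (n + 1)) : Vertex n) false)).1
      simp only [Fin.update_snoc_last] at this
      simpa [F, ψ₁, ψ₂, ht, hu] using this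
    · simp [F, ht]
  obtain ⟨Q, hQ, hQF⟩ := hX.exists_extension P (by
      intro a b hba ha
      simp only [P, Finset.coe_filter, Finset.mem_univ, true_and, Set.mem_ofPred_eq] at ha ⊢
      exact ha.imp (fun h => le_bot_iff.1 ((hba t).trans h.le))
        fun h => le_bot_iff.1 ((hba s).trans h.le)) F (by
      intro u hu
      simp only [P, Finset.mem_filter, Finset.mem_univ, true_and] at hu
      rcases hu with hu | hu
      · have := hX.composition _ _ _ (hψ₁.comp (isCubeMorphism_inf u)) _ h₁
        convert this using 1
        funext w
        simp [F, hu]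
      · have := hX.composition _ _ _ (hψ₂.comp (isCubeMorphism_inf u)) _ h₂
        convert this using 1
        funext w
        exact hF₂ _ (by simp [hu]))
  have hc : ConcatAt (Fin.last n) φ₁ φ₂ φ₃ := fun v => by simp [φ₁, φ₂, φ₃, Fin.init_update_last]
  have e₁ : Q ∘ φ₁ = q₁ := by
    funext v
    rw [Function.comp_apply, hQF _ (by simp [P, φ₁, t])]
    simp [F, φ₁, ψ₁, t, s]
  have e₂ : Q ∘ φ₂ = q₂ := by
    funext v
    rw [Function.comp_apply, hQF _ (by simp [P, φ₂, s]), hF₂ _ (by simp [φ₂, s])]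
    simp [φ₂, ψ₂, t]
  refine ⟨Q, hQ, φ₁, φ₂, φ₃, (hinit.snoc_not _).snoc_const _, (hinit.snoc_const _).snoc_var _,
    (hinit.snoc_not _).snoc_var _, hc, e₁, e₂, funext fun v => ?_⟩
  rw [← Function.update_eq_self (Fin.last n) v]
  cases v (Fin.last n)
  · rw [Function.comp_apply, (hc v).2.1, (h v).2.1, ← e₁, Function.comp_apply]
  · rw [Function.comp_apply, (hc v).2.2, (h v).2.2, ← e₂, Function.comp_apply]

theorem IsConcatenation.concatAt {X : Type u} {n : ℕ} {q₁ q₂ q₃ : Vertex (n + 1) → X}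
    (h : IsConcatenation q₁ q₂ q₃) : ConcatAt (Fin.last n) q₁ q₂ q₃ := by
  intro v
  have e : ∀ b, Function.update v (Fin.last n) b = Fin.snoc (Fin.init v : Vertex n) b := by
    intro b
    conv_lhs => rw [← Fin.snoc_init_self v]
    rw [Fin.update_snoc_last]
  rw [e, e]
  exact ⟨h.1 _, h.2.1 _, h.2.2 _⟩

theorem ConcatAt.isConcatenation {X : Type u} {n : ℕ} {q₁ q₂ q₃ : Vertex (n + 1) → X}
    (h : ConcatAt (Fin.last n) q₁ q₂ q₃) : IsConcatenation q₁ q₂ q₃ := by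
  have := fun w : Vertex n => h (Fin.snoc w false)
  simp only [Fin.update_snoc_last] at this
  exact ⟨fun w => (this w).1, fun w => (this w).2.1, fun w => (this w).2.2⟩

end Nilspace

/-! ### Pulling cocycles back to discrete cubes. -/

section Cocycles

variable {X : Type u} [CubeStructure X] {Z : Type v} [AddCommGroup Z] {k n : ℕ}

open Classical in
/-- The extension by zero of a function of cubes to all maps. -/
noncomputable def extendByZero (ρ : Cu X n → Z) (q : Vertex n → X) : Z :=
  if h : q ∈ Cu X n then ρ ⟨q, h⟩ else 0

theorem extendByZero_of_mem (ρ : Cu X n → Z) {q : Vertex n → X} (h : q ∈ Cu X n) :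
    extendByZero ρ q = ρ ⟨q, h⟩ := dif_pos h

/-- A cocycle on `X` pulls back along a cube to a cocycle on the discrete cube. -/
theorem IsCocycle.isCubeCocycle {ρ : Cu X (k + 1) → Z} (hρ : IsCocycle ρ)
    (hX : CompositionAxiom X) {q : Vertex n → X} (hq : q ∈ Cu X n) :
    IsCubeCocycle fun φ : Vertex (k + 1) → Vertex n => extendByZero ρ (q ∘ φ) := by
  have hperm : ∀ φ : Vertex (k + 1) → Vertex n, IsCubeMorphism φ →
      ∀ f : Fin (k + 1) → Fin (k + 1), Function.Injective f →
      extendByZero ρ (q ∘ fun v => φ (v ∘ f)) = extendByZero ρ (q ∘ φ) := by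
    intro φ hφ f hf
    have hqφ := hX _ _ φ hφ q hq
    have hqφf := hX _ _ _ (hφ.comp (isCubeMorphism_reindex f)) q hq
    have := hρ.aut ⟨_, hqφ⟩ ⟨_, hqφf⟩ _ (isCubeAut_reindex hf) rfl
    rw [reflections_reindex, pow_zero, one_smul] at this
    rw [extendByZero_of_mem ρ hqφ, ← this]
    exact extendByZero_of_mem ρ hqφf
  refine ⟨hperm, fun i φ₁ φ₂ φ₃ h₁ h₂ h₃ hc => ?_⟩
  -- The cocycle axiom concatenates only along the last coordinate; conjugating by a transposition
  -- gives every coordinate.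
  have hsw := (Equiv.swap i (Fin.last k)).injective
  have hc' : ConcatAt (Fin.last k) (fun v => φ₁ (v ∘ Equiv.swap i (Fin.last k)))
      (fun v => φ₂ (v ∘ Equiv.swap i (Fin.last k)))
      (fun v => φ₃ (v ∘ Equiv.swap i (Fin.last k))) := by
    intro v
    have e : ∀ b, (Function.update v (Fin.last k) b : Vertex (k + 1)) ∘ Equiv.swap i (Fin.last k) =
        Function.update (v ∘ Equiv.swap i (Fin.last k)) i b := by
      intro b
      rw [Function.update_comp_equiv]
      simp
    simp only [e]
    exact hc _
  have hm : ∀ φ : Vertex (k + 1) → Vertex n, IsCubeMorphism φ →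
      (q ∘ fun v => φ (v ∘ Equiv.swap i (Fin.last k))) ∈ Cu X (k + 1) := fun φ hφ =>
    hX _ _ _ (hφ.comp (isCubeMorphism_reindex (Equiv.swap i (Fin.last k)))) q hq
  rw [← hperm φ₁ h₁ _ hsw, ← hperm φ₂ h₂ _ hsw, ← hperm φ₃ h₃ _ hsw,
    extendByZero_of_mem ρ (hm _ h₁), extendByZero_of_mem ρ (hm _ h₂),
    extendByZero_of_mem ρ (hm _ h₃)]
  exact hρ.concat _ _ _ (hc'.comp_left q).isConcatenation

end Cocycles

/-! ### Trivializations and the extension axioms. -/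

section Trivialization

variable {X : Type u} [CubeStructure X] {Z : Type v} [AddCommGroup Z] {k : ℕ}
  {W : Type*} [CubeStructure W] {W' : Type*} [CubeStructure W']

/-- `(π, h)` identifies the set `W` with `X × Z`, in such a way that its cubes are the maps lying
over a cube of `X` whose second component has alternating sum `ρ` on every standard
`(k+1)`-face. -/
structure IsTrivialization (ρ : Cu X (k + 1) → Z) (π : W → X) (h : W → Z) : Prop where
  bij : Function.Bijective fun w => (π w, h w)
  mem_iff : ∀ (n : ℕ) (f : Vertex n → W), f ∈ Cu W n ↔ π ∘ f ∈ Cu X n ∧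
    ∀ φ : Vertex (k + 1) → Vertex n, IsStandardFaceMap φ →
      extendByZero ρ (π ∘ f ∘ φ) = sigma (h ∘ f ∘ φ)

namespace IsTrivialization

variable {ρ : Cu X (k + 1) → Z} {π : W → X} {h : W → Z} {π' : W' → X} {h' : W' → Z}

theorem isIsomorphic (H : IsTrivialization ρ π h) (H' : IsTrivialization ρ π' h') :
    IsIsomorphic W W' := by
  let e : W ≃ W' := (Equiv.ofBijective _ H.bij).trans (Equiv.ofBijective _ H'.bij).symm
  have he : ∀ w, (π' (e w), h' (e w)) = (π w, h w) := fun w =>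
    (Equiv.ofBijective _ H'.bij).apply_symm_apply (π w, h w)
  have hπ : π' ∘ e = π := funext fun w => congrArg Prod.fst (he w)
  have hh : h' ∘ e = h := funext fun w => congrArg Prod.snd (he w)
  refine ⟨e, fun n q => ?_⟩
  rw [H.mem_iff, H'.mem_iff, ← hπ, ← hh]
  rfl

/-- Changing the cocycle by a coboundary amounts to changing the second coordinate. -/
theorem add_coboundary (H : IsTrivialization ρ π h) (hX : CompositionAxiom X) (f : X → Z) :
    IsTrivialization (ρ + coboundaryHom k X Z f) π (h + f ∘ π) where
  bij := by
    constructor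
    · intro w w' hw
      simp only [Prod.mk.injEq, Pi.add_apply, Function.comp_apply] at hw
      refine H.bij.1 (Prod.ext hw.1 ?_)
      have := hw.2
      rw [hw.1] at this
      exact add_right_cancel this
    · rintro ⟨x, z⟩
      obtain ⟨w, hw⟩ := H.bij.2 (x, z - f x)
      simp only [Prod.mk.injEq] at hw
      exact ⟨w, by simp [hw.1, hw.2]⟩
  mem_iff n g := by
    rw [H.mem_iff]
    refine and_congr_right fun hg => forall₂_congr fun φ hφ => ?_
    have hm : π ∘ g ∘ φ ∈ Cu X (k + 1) := hX _ _ φ hφ.isCubeMorphism _ hg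
    rw [extendByZero_of_mem _ hm, extendByZero_of_mem _ hm]
    have : (h + f ∘ π) ∘ g ∘ φ = h ∘ g ∘ φ + f ∘ π ∘ g ∘ φ := rfl
    rw [this, sigma_add]
    exact (add_left_inj _).symm

/-- Both sides are cube cocycles in `φ` that agree on standard face maps, hence on all morphisms.
This gives the composition axiom for `W`. -/
theorem extendByZero_eq_sigma (H : IsTrivialization ρ π h) (hρ : IsCocycle ρ)
    (hX : CompositionAxiom X) {n : ℕ} {f : Vertex n → W} (hf : f ∈ Cu W n)
    {φ : Vertex (k + 1) → Vertex n} (hφ : IsCubeMorphism φ) :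
    extendByZero ρ (π ∘ f ∘ φ) = sigma (h ∘ f ∘ φ) := by
  obtain ⟨hq, hf'⟩ := (H.mem_iff n f).1 hf
  exact sub_eq_zero.1 <| ((hρ.isCubeCocycle hX hq).sub
    (isCubeCocycle_sigma (h ∘ f))).eq_zero_of_standardFaceMap
      (fun χ hχ => sub_eq_zero.2 (hf' χ hχ)) φ hφ

theorem isDegreeExtension [AddAction Z W] (H : IsTrivialization ρ π h) (hρ : IsCocycle ρ)
    (hX : IsNilspace X) (hπ : ∀ (z : Z) w, π (z +ᵥ w) = π w)
    (hh : ∀ (z : Z) w, h (z +ᵥ w) = h w - z) : IsDegreeExtension k Z π where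
  bundle := by
    have horbit : ∀ w, π ⁻¹' {π w} = AddAction.orbit Z w := by
      intro w
      ext w'
      constructor
      · intro hw
        refine ⟨h w - h w', H.bij.1 (Prod.ext ?_ ?_)⟩
        · exact (hπ _ _).trans (Eq.symm hw)
        · simp [hh]
      · rintro ⟨z, rfl⟩
        exact hπ z w
    have hsurj : Function.Surjective π := fun x => by
      obtain ⟨w, hw⟩ := H.bij.2 (x, 0)
      exact ⟨w, congrArg Prod.fst hw⟩
    refine ⟨fun w => Set.ext fun z => ⟨fun hz => ?_, ?_⟩, fun x _ => ?_, fun x _ y _ hxy => ?_, ?_⟩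
    · have := hh z w
      rw [Set.mem_ofPred_eq] at hz
      rw [hz] at this
      exact sub_eq_self.1 this.symm
    · rintro rfl
      exact zero_vadd Z w
    · obtain ⟨w, rfl⟩ := hsurj x
      exact ⟨w, (horbit w).symm⟩
    · obtain ⟨w, rfl⟩ := hsurj x
      have : w ∈ π ⁻¹' {y} := by
        rw [← show π ⁻¹' {π w} = π ⁻¹' {y} from hxy]
        rfl
      exact this
    · rintro _ ⟨w, rfl⟩
      exact ⟨π w, trivial, horbit w⟩
  cubespace := by
    refine ⟨fun m n ψ hψ f hf => (H.mem_iff m _).2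
      ⟨hX.composition _ _ ψ hψ _ ((H.mem_iff n f).1 hf).1, fun φ hφ =>
        H.extendByZero_eq_sigma hρ hX.composition hf (hψ.comp hφ.isCubeMorphism)⟩, ?_⟩
    refine Set.eq_univ_of_forall fun f => (H.mem_iff 0 f).2 ⟨?_, fun φ hφ => ?_⟩
    · convert hX.const_mem 0 (π (f default)) using 1
      funext v
      rw [Subsingleton.elim v default, Function.comp_apply]
    · obtain ⟨e, -⟩ := hφ
      exact (e 0).elim0
  cubes_surj n := by
    refine Set.Subset.antisymm ?_ fun q hq => ?_
    · rintro _ ⟨f, hf, rfl⟩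
      exact ((H.mem_iff n f).1 hf).1
    -- The primitive `a` of the pulled-back cocycle supplies the heights of a lift of `q`.
    · obtain ⟨a, ha⟩ := (hρ.isCubeCocycle hX.composition hq).exists_eq_sigma
      choose f hf using fun v => H.bij.2 (q v, a v)
      have hπf : π ∘ f = q := funext fun v => congrArg Prod.fst (hf v)
      have hhf : h ∘ f = a := funext fun v => congrArg Prod.snd (hf v)
      refine ⟨f, (H.mem_iff n f).2 ⟨hπf ▸ hq, fun φ hφ => ?_⟩, hπf⟩
      rw [← Function.comp_assoc, ← Function.comp_assoc, hπf, hhf]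
      exact ha φ hφ.isCubeMorphism
  cubes_fibre n f hf := by
    have hf' := (H.mem_iff n f).1 hf
    ext g
    constructor
    · rintro ⟨hg, hgf⟩
      have hg' := (H.mem_iff n g).1 hg
      refine ⟨h ∘ f - h ∘ g, mem_degreeCubes_iff.2 fun φ hφ => ?_, funext fun v => ?_⟩
      · have : (h ∘ f - h ∘ g) ∘ φ = h ∘ f ∘ φ - h ∘ g ∘ φ := rfl
        rw [this, sigma_sub, ← hf'.2 φ hφ, ← hg'.2 φ hφ, ← Function.comp_assoc π,
          ← Function.comp_assoc π, hgf, sub_self]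
      · refine H.bij.1 (Prod.ext ?_ ?_)
        · exact (congrFun hgf v).trans (hπ _ _).symm
        · simp [hh]
    · rintro ⟨a, ha, rfl⟩
      have hπg : (π ∘ fun v => a v +ᵥ f v) = π ∘ f := funext fun v => hπ _ _
      have hhg : (h ∘ fun v => a v +ᵥ f v) = h ∘ f - a := funext fun v => hh _ _
      refine ⟨(H.mem_iff n _).2 ⟨hπg ▸ hf'.1, fun φ hφ => ?_⟩, hπg⟩
      rw [← Function.comp_assoc, ← Function.comp_assoc, hπg, hhg]
      have : (h ∘ f - a) ∘ φ = h ∘ f ∘ φ - a ∘ φ := rfl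
      rw [this, sigma_sub, mem_degreeCubes_iff.1 ha φ hφ, sub_zero]
      exact hf'.2 φ hφ

end IsTrivialization

end Trivialization

/-! ### The space `M(ρ)`. -/

namespace CocycleExt

variable {k : ℕ} {X : Type u} [CubeStructure X] {Z : Type v} [AddCommGroup Z]
  {ρ : Cu X (k + 1) → Z}

theorem exists_vadd_eq_origin (p : CocycleExt ρ) : ∃ a : Z, a +ᵥ p = origin ρ (proj ρ p) := by
  obtain ⟨x, f, z, hz⟩ := p
  refine ⟨-z, CocycleExt.ext rfl (heq_of_eq (funext fun c => ?_))⟩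
  change f c + -z = ρ c.1
  rw [hz, add_neg_cancel_right]

/-- The element `a` of `Z` such that `p + a = ρ_x`, where `x` is the projection of `p`. -/
noncomputable def height (p : CocycleExt ρ) : Z := (exists_vadd_eq_origin p).choose

theorem height_vadd (p : CocycleExt ρ) : height p +ᵥ p = origin ρ (proj ρ p) :=
  (exists_vadd_eq_origin p).choose_spec

/-- Evaluating at the constant cube recovers the translation; without a cube based at `x` the
functions `ρ_x + z` would coincide. -/
theorem vadd_left_injective (hX : IsNilspace X) (p : CocycleExt ρ) :
    Function.Injective fun a : Z => a +ᵥ p := by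
  intro a b hab
  obtain ⟨x, f, hf⟩ := p
  have h := CocycleExt.ext_iff.1 hab
  have := congrFun (eq_of_heq h.2) ⟨⟨_, hX.const_mem (k + 1) x⟩, rfl⟩
  exact add_left_cancel this

theorem eq_height (hX : IsNilspace X) {p : CocycleExt ρ} {a : Z}
    (h : a +ᵥ p = origin ρ (proj ρ p)) : a = height p :=
  vadd_left_injective hX p (h.trans (height_vadd p).symm)

theorem proj_vadd (z : Z) (p : CocycleExt ρ) : proj ρ (z +ᵥ p) = proj ρ p := rfl

theorem height_vadd_eq_sub (hX : IsNilspace X) (z : Z) (p : CocycleExt ρ) :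
    height (z +ᵥ p) = height p - z := by
  refine (eq_height hX ?_).symm
  rw [vadd_vadd, sub_add_cancel]
  exact height_vadd p

theorem isTopCube_iff (hX : IsNilspace X) (f : Vertex (k + 1) → CocycleExt ρ) :
    IsTopCube ρ f ↔ proj ρ ∘ f ∈ Cu X (k + 1) ∧
      extendByZero ρ (proj ρ ∘ f) = sigma (height ∘ f) := by
  constructor
  · rintro ⟨h, a, ha, hρ⟩
    have : a = height ∘ f := funext fun v => eq_height hX (ha v)
    exact ⟨h, by rw [extendByZero_of_mem ρ h, hρ, this]⟩
  · rintro ⟨h, hρ⟩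
    exact ⟨h, height ∘ f, fun v => height_vadd _, by rw [← hρ, extendByZero_of_mem ρ h]⟩

theorem isTrivialization (hX : IsNilspace X) (ρ : Cu X (k + 1) → Z) :
    IsTrivialization ρ (proj ρ) height where
  bij := by
    constructor
    · intro p p' h
      simp only [Prod.mk.injEq] at h
      have h1 := height_vadd p
      have h2 := height_vadd p'
      rw [h.1, h.2, ← h2] at h1
      exact vadd_left_cancel _ h1
    · rintro ⟨x, z⟩
      refine ⟨-z +ᵥ origin ρ x, Prod.ext rfl ?_⟩
      refine (eq_height hX ?_).symm
      rw [vadd_vadd, add_neg_cancel, zero_vadd]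
      rfl
  mem_iff n f := by
    refine and_congr_right fun hf => forall₂_congr fun φ hφ => ?_
    rw [isTopCube_iff hX]
    exact and_iff_right (hX.composition _ _ φ hφ.isCubeMorphism _ hf)

theorem isDegreeExtension (hX : IsNilspace X) {ρ : Cu X (k + 1) → Z} (hρ : IsCocycle ρ) :
    IsDegreeExtension k Z (proj ρ) :=
  (isTrivialization hX ρ).isDegreeExtension hρ hX proj_vadd (height_vadd_eq_sub hX)

theorem isIsomorphic_of_sub_mem (hX : IsNilspace X) {ρ ρ' : Cu X (k + 1) → Z}
    (h : ρ' - ρ ∈ (coboundaryHom k X Z).range) :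
    IsIsomorphic (CocycleExt ρ) (CocycleExt ρ') := by
  obtain ⟨f, hf⟩ := h
  have := (isTrivialization hX ρ).add_coboundary hX.composition f
  rw [hf, add_sub_cancel] at this
  exact this.isIsomorphic (isTrivialization hX ρ')

end CocycleExt

/-! ### Fibres of an abelian bundle as free orbits. -/

section Bundle

variable {Z : Type v} [AddCommGroup Z] {B S : Type*} [AddAction Z B] {π : B → S}

namespace IsAbelianBundle

theorem preimage_eq_orbit (h : IsAbelianBundle Z π) (y : B) :
    π ⁻¹' {π y} = AddAction.orbit Z y := by
  obtain ⟨s, -, hs⟩ := h.fibres.surjOn ⟨y, rfl⟩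
  have hy : y ∈ π ⁻¹' {s} := by
    rw [show π ⁻¹' {s} = AddAction.orbit Z y from hs]
    exact AddAction.mem_orbit_self y
  rw [show π y = s from hy]
  exact hs

theorem proj_vadd (h : IsAbelianBundle Z π) (z : Z) (y : B) : π (z +ᵥ y) = π y := by
  have : z +ᵥ y ∈ π ⁻¹' {π y} := h.preimage_eq_orbit y ▸ AddAction.mem_orbit y z
  exact this

theorem exists_vadd_eq (h : IsAbelianBundle Z π) {y y' : B} (hy : π y' = π y) :
    ∃ z : Z, z +ᵥ y = y' := by
  have : y' ∈ π ⁻¹' {π y} := hy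
  rwa [h.preimage_eq_orbit y] at this

theorem surjective (h : IsAbelianBundle Z π) : Function.Surjective π := by
  intro s
  obtain ⟨y, hy⟩ := h.fibres.mapsTo (Set.mem_univ s)
  have : y ∈ π ⁻¹' {s} := by
    rw [← show AddAction.orbit Z y = π ⁻¹' {s} from hy]
    exact AddAction.mem_orbit_self y
  exact ⟨y, this⟩

theorem vadd_left_injective (h : IsAbelianBundle Z π) (y : B) :
    Function.Injective fun z : Z => z +ᵥ y := by
  intro a b hab
  have hmem : -b + a ∈ {z : Z | z +ᵥ y = y} := by
    rw [Set.mem_ofPred_eq, add_vadd, show a +ᵥ y = b +ᵥ y from hab, neg_vadd_vadd]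
  rw [h.free y, Set.mem_singleton_iff, neg_add_eq_zero] at hmem
  exact hmem.symm

end IsAbelianBundle

end Bundle

/-! ### From an extension to a cocycle. -/

section Classification

variable {X : Type u} [CubeStructure X] {Z : Type v} [AddCommGroup Z] {k : ℕ}
  {Y : Type*} [CubeStructure Y] [AddAction Z Y] {π : Y → X}

/-- Every degree-`k` extension is trivialized by a cocycle. -/
theorem IsDegreeExtension.exists_isTrivialization (hX : IsNilspace X)
    (E : IsDegreeExtension k Z π) :
    ∃ (ρ : Cu X (k + 1) → Z) (h : Y → Z), IsCocycle ρ ∧ IsTrivialization ρ π h := by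
  let s := Function.surjInv E.bundle.surjective
  have hs : ∀ x, π (s x) = x := Function.surjInv_eq E.bundle.surjective
  -- The height is the translation taking `y` to the base point of its fibre, hence the minus sign
  -- in `hvadd`.
  choose h hh using fun y : Y => E.bundle.exists_vadd_eq (hs (π y))
  have hvadd : ∀ (z : Z) (y : Y), h (z +ᵥ y) = h y - z := by
    intro z y
    refine E.bundle.vadd_left_injective (z +ᵥ y) ?_
    simp only
    rw [hh, vadd_vadd, sub_add_cancel, hh, E.bundle.proj_vadd]
  have hlift : ∀ n, ∀ q ∈ Cu X n, ∃ g ∈ Cu Y n, π ∘ g = q := fun n q hq => by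
    rwa [← E.cubes_surj n] at hq
  choose lift hliftmem hliftπ using fun q : Cu X (k + 1) => hlift _ q.1 q.2
  let ρ : Cu X (k + 1) → Z := fun q => sigma (h ∘ lift q)
  have hfibre : ∀ n, ∀ g ∈ Cu Y n, ∀ g' ∈ Cu Y n, π ∘ g' = π ∘ g →
      h ∘ g - h ∘ g' ∈ degreeCubes k Z n := by
    intro n g hg g' hg' hgg'
    have hmem : g' ∈ {q₂ | q₂ ∈ Cu Y n ∧ π ∘ q₂ = π ∘ g} := ⟨hg', hgg'⟩
    rw [E.cubes_fibre n g hg] at hmem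
    obtain ⟨a, ha, rfl⟩ := hmem
    convert ha using 1
    funext v
    simp [hvadd]
  have hid : IsStandardFaceMap fun v : Vertex (k + 1) => v :=
    ⟨RelEmbedding.refl _, default, fun v => ⟨fun i => rfl, fun j hj => absurd ⟨j, rfl⟩ hj⟩⟩
  have hρ : ∀ g ∈ Cu Y (k + 1), ∀ q : Cu X (k + 1), π ∘ g = q.1 → ρ q = sigma (h ∘ g) := by
    intro g hg q hq
    have := mem_degreeCubes_iff.1
      (hfibre _ _ (hliftmem q) g hg (by rw [hq, hliftπ])) _ hid
    exact sub_eq_zero.1 ((sigma_sub _ _).symm.trans this)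
  refine ⟨ρ, h, ⟨fun q q' θ hθ hq => ?_, fun q₁ q₂ q₃ hq => ?_⟩, ⟨?_, ?_⟩, fun n f => ?_⟩
  · rw [hρ (lift q ∘ θ) (E.cubespace.composition _ _ θ hθ.1 _ (hliftmem q)) q'
      (by rw [← Function.comp_assoc, hliftπ, hq])]
    exact sigma_comp_aut hθ (h ∘ lift q)
  · obtain ⟨Q, hQ, φ₁, φ₂, φ₃, h₁, h₂, h₃, hc, e₁, e₂, e₃⟩ :=
      hX.exists_cube_of_concatAt q₁.2 q₂.2 hq.concatAt
    obtain ⟨g, hg, rfl⟩ := hlift _ Q hQ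
    rw [hρ (g ∘ φ₁) (E.cubespace.composition _ _ _ h₁ g hg) q₁ e₁,
      hρ (g ∘ φ₂) (E.cubespace.composition _ _ _ h₂ g hg) q₂ e₂,
      hρ (g ∘ φ₃) (E.cubespace.composition _ _ _ h₃ g hg) q₃ e₃]
    exact sigma_concatAt (hc.comp_left (h ∘ g))
  · intro y y' hy
    simp only [Prod.mk.injEq] at hy
    have h1 := hh y
    rw [hy.1, hy.2, ← hh y'] at h1
    exact vadd_left_cancel _ h1
  · rintro ⟨x, z⟩
    refine ⟨-z +ᵥ s x, Prod.ext ((E.bundle.proj_vadd _ _).trans (hs x)) ?_⟩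
    have : h (s x) = 0 := by
      refine E.bundle.vadd_left_injective (s x) ?_
      simp only
      rw [hh, hs, zero_vadd]
    simp [hvadd, this]
  · have hface : ∀ g ∈ Cu Y n, ∀ φ : Vertex (k + 1) → Vertex n, IsStandardFaceMap φ →
        extendByZero ρ (π ∘ g ∘ φ) = sigma (h ∘ g ∘ φ) := by
      intro g hg φ hφ
      have hgφ := E.cubespace.composition _ _ φ hφ.isCubeMorphism g hg
      have hm : π ∘ g ∘ φ ∈ Cu X (k + 1) := by
        rw [← E.cubes_surj]
        exact ⟨_, hgφ, rfl⟩
      rw [extendByZero_of_mem ρ hm]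
      exact hρ _ hgφ _ rfl
    constructor
    · intro hf
      refine ⟨?_, hface f hf⟩
      rw [← E.cubes_surj]
      exact ⟨f, hf, rfl⟩
    -- Compared with a lift `g` of the base cube, `f` differs by heights with zero sum on every
    -- face, that is, by a cube of `D_k(Z)`; the fibre axiom then makes `f` a cube.
    · rintro ⟨hπf, hf⟩
      obtain ⟨g, hg, hgf⟩ := hlift _ _ hπf
      choose a ha using fun v => E.bundle.exists_vadd_eq (congrFun hgf v).symm
      have hf' : f = fun v => a v +ᵥ g v := funext fun v => (ha v).symm
      have ha' : a = h ∘ g - h ∘ f := by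
        funext v
        simp [← ha v, hvadd]
      have hmem : f ∈ {q₂ | ∃ q₃ ∈ degreeCubes k Z n, q₂ = fun v => q₃ v +ᵥ g v} := by
        refine ⟨a, mem_degreeCubes_iff.2 fun φ hφ => ?_, hf'⟩
        have : a ∘ φ = h ∘ g ∘ φ - h ∘ f ∘ φ := by rw [ha']; rfl
        rw [this, sigma_sub, ← hface g hg φ hφ, ← hf φ hφ, ← Function.comp_assoc π,
          ← Function.comp_assoc π, hgf, sub_self]
      rw [← E.cubes_fibre n g hg] at hmem
      exact hmem.1

end Classification

end CubeNil

theorem corollary3p3p20 {X : Type*} [CubeNil.CubeStructure X] (hX : CubeNil.IsNilspace X)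
    {Z : Type*} [AddCommGroup Z] (k : ℕ) :
    ∃ Φ : CubeNil.Cohomology k X Z → CubeNil.ExtensionClass k X Z,
      (∀ ρ : CubeNil.cocycles k X Z,
        ∃ hM : CubeNil.IsDegreeExtension k Z (CubeNil.CocycleExt.proj ρ.1),
          Φ (QuotientAddGroup.mk ρ) =
            Quotient.mk (CubeNil.DegreeExtension.isoSetoid k X Z)
              { carrier := CubeNil.CocycleExt ρ.1
                proj := CubeNil.CocycleExt.proj ρ.1
                isExtension := hM }) ∧
      Function.Surjective Φ := by
  let toExt : CubeNil.cocycles k X Z → CubeNil.DegreeExtension k X Z := fun ρ =>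
    { carrier := CubeNil.CocycleExt ρ.1
      proj := CubeNil.CocycleExt.proj ρ.1
      isExtension := CubeNil.CocycleExt.isDegreeExtension hX ρ.2 }
  have hΦ : ∀ ρ ρ' : CubeNil.cocycles k X Z,
      QuotientAddGroup.leftRel (CubeNil.coboundaries k X Z) ρ ρ' →
      Quotient.mk (CubeNil.DegreeExtension.isoSetoid k X Z) (toExt ρ) =
        Quotient.mk (CubeNil.DegreeExtension.isoSetoid k X Z) (toExt ρ') := by
    intro ρ ρ' h
    rw [QuotientAddGroup.leftRel_apply] at h
    refine Quotient.sound (CubeNil.CocycleExt.isIsomorphic_of_sub_mem hX ?_)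
    have := AddSubgroup.mem_addSubgroupOf.1 h
    rwa [AddSubgroup.coe_add, AddSubgroup.coe_neg, neg_add_eq_sub] at this
  refine ⟨Quotient.lift (fun ρ => Quotient.mk _ (toExt ρ)) hΦ, fun ρ =>
    ⟨CubeNil.CocycleExt.isDegreeExtension hX ρ.2, rfl⟩, fun C => ?_⟩
  induction C using Quotient.inductionOn with
  | h E =>
    obtain ⟨ρ, h, hρ, H⟩ := E.isExtension.exists_isTrivialization hX
    exact ⟨QuotientAddGroup.mk ⟨ρ, hρ⟩,
      Quotient.sound ((CubeNil.CocycleExt.isTrivialization hX ρ).isIsomorphic H)⟩
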